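/- **Setting.** A network in a bounded measurable area $\mathcal A\subset\mathbb R^2$ has $n+1$ base stations: the macro cell $s=0$ and the small cells $s=1,\dots,n$. The parameter $P=(P_s)_{1\le s\le n}\in\mathbb R^n$ collects the pilot power plus cell individual offset (CIO) of the small cells; the value $P_0$ of the macro cell is fixed. With $h_{s,r}>0$ the downlink gain from station $s$ to location $r$, the coverage area of station $s$ is $$\mathcal A_s(P)=\{r\in\mathcal A : h_{s,r}P_s=\max_{s'}h_{s',r}P_{s'}\}.$$ There are $N_{PRB}\ge1$ resource blocks of bandwidth $W>0$, and the noise density is $N_0>0$. For each $P$ there is a finite set of active users, each with a set of resource blocks used in the uplink. A user at $r$ served by $s$ on $M$ blocks transmits, on the dB scale, with total power $\min\{P_{\max},\,P_{0,s,r}+10\log_{10}M+\alpha_s L_{s,r}+\Delta_r\}$, where $L_{s,r}=-10\log_{10}h_{s,r}$ and the other symbols are given parameters; on the linear scale this power is split equally over the $M$ blocks, and the power on all other blocks is $0$. Let $SU^{(k)}_{r,s}(P)$ be the uplink ratio of received power to $WN_0$ plus interference at station $s$ on block $k$, for a user at $r$ served by $s$ on all blocks, where the interferers are the active users in $\mathcal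 A_{s'}(P)$, $s'\ne s$ (uplink gains $h_{r,s}>0$). Given a spectral efficiency function $\phi$ with $0\le\phi(x)\le\log_2(1+x)$ for $x\ge 0$ and a fading density $p_\xi$ on $(0,\infty)$, the peak uplink rate and the uplink load are $$R_s(r,P)=\sum_k W\int_0^\infty\phi(SU^{(k)}_{r,s}(P)\,x)\,p_\xi(x)\,dx,\qquad \bar\rho_s(P)=\int_{\mathcal A_s(P)}\frac{\lambda(r)\,\mathbb E(\sigma_U)}{R_s(r,P)}\,dr\in[0,\infty],$$ where $\lambda\ge0$ is the arrival rate of users and $\mathbb E(\sigma_U)<\infty$ the mean size of an uploaded file. With downlink powers $p_s^{(k)}\ge0$, the downlink ratio is $SD^{(k)}_{r,s}=p_s^{(k)}h_{s,r}/(WN_0+\sum_{s'\ne s}p_{s'}^{(k)}h_{s',r})$. The outage $\theta_s(P)\in[0,1]$ is the proportion, among the pairs of an active user $r$ in $\mathcal A_s(P)$ and a block $k$, of those for which $SD^{(k)}_{r,s}$ is below a given threshold ($\theta_s(P)=0$ if there is no such user). All these data are arbitrary (functions of locations being measurable), except that the uplink loads satisfy $\bar\rho_s(P)\le1$ for all $P$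 and all $s=0,\dots,n$. Given an outage threshold $\bar\theta\in\mathbb R$, define $h:\mathbb R^n\to\mathbb R^n$ by $$h_s(P)=\begin{cases}\bar\rho_0(P)-\bar\rho_s(P)&\text{if }\theta_s(P)<\bar\theta,\\ \bar\theta-\theta_s(P)&\text{otherwise,}\end{cases}\qquad s=1,\dots,n,$$ and, with $\overline{\mathrm{co}}$ the closed convex hull, let $$g(P)=\bigcap_{\gamma>0}\overline{\mathrm{co}}\,\{h(P') : \|P'-P\|<\gamma\}.$$ **Proposition 1.** (a) $h(P)\in g(P)$ for every $P\in\mathbb R^n$. Consequently the load-balancing iteration $P(t+1)=P(t)+\varepsilon\,h(P(t))$ is a special case of the recursive inclusion $$P(t+1)=P(t)+\varepsilon\,y(t),\qquad y(t)\in g(P(t)),\qquad t=0,1,2,\dots\qquad(\ast)$$ that is, for every $\varepsilon$, each sequence that satisfies the iteration satisfies $(\ast)$. (b) The differential inclusion $\dot P\in g(P)$ is the limit of $(\ast)$ as the step size tends to $0$, in the following sense. Let $\varepsilon_k>0$ with $\varepsilon_k\to0$, let $P^k$ be any trajectory of $(\ast)$ with step $\varepsilon_k$, and let $X^k:[0,\infty)\to\mathbb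 R^n$ be the piecewise affine interpolation with $X^k(\varepsilon_k t)=P^k(t)$, $t=0,1,2,\dots$. If $X^k\to x$ uniformly on compact subsets of $[0,\infty)$, then $x$ solves the differential inclusion: it is absolutely continuous on compact intervals and $\dot x(\tau)\in g(x(\tau))$ for almost every $\tau\ge0$. If the initial values $P^k(0)$ are bounded, then some subsequence of $(X^k)$ converges uniformly on compact subsets of $[0,\infty)$. -/

import Mathlib

open MeasureTheory Filter Topology
open scoped NNReal ENNReal

noncomputable section

/-! ### The heterogeneous network -/

/-- Locations in the plane. -/
abbrev Location : Type := EuclideanSpace ℝ (Fin 2)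

/-- The vector `P = (P_s)` of the pilot power plus cell individual offset of each of the `n` small
cells. -/
abbrev Param (n : ℕ) : Type := EuclideanSpace ℝ (Fin n)

/-- A network with `n + 1` base stations: station `0` is the macro cell, station `s.succ` is the
small cell `s`. Powers and gains are linear, except for the quantities marked dB. -/
structure HetNet (n : ℕ) where
  /-- the served area -/
  area : Set Location
  area_bounded : Bornology.IsBounded area
  area_measurable : MeasurableSet area
  /-- number of physical resource blocks (PRBs) of each station -/
  numPRB : ℕ
  numPRB_pos : 0 < numPRB
  /-- bandwidth of one PRB -/
  prbBandwidth : ℝ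
  prbBandwidth_pos : 0 < prbBandwidth
  /-- thermal noise spectral power density -/
  noise : ℝ
  noise_pos : 0 < noise
  /-- uplink gain from a location to a station -/
  ulGain : Fin (n + 1) → Location → ℝ
  ulGain_pos : ∀ s r, 0 < ulGain s r
  ulGain_measurable : ∀ s, Measurable (ulGain s)
  /-- downlink gain from a station to a location -/
  dlGain : Fin (n + 1) → Location → ℝ
  dlGain_pos : ∀ s r, 0 < dlGain s r
  dlGain_measurable : ∀ s, Measurable (dlGain s)
  /-- maximal transmit power of a terminal (dB) -/
  maxTxPower : ℝ
  /-- user- or cell-specific power control parameter `P₀` (dB) -/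
  basePower : Fin (n + 1) → Location → ℝ
  basePower_measurable : ∀ s, Measurable (basePower s)
  /-- cell-specific pathloss compensation factor `α` -/
  compensation : Fin (n + 1) → ℝ
  /-- modulation and closed-loop correction `Δ_mcs + f(Δ_r)` (dB) -/
  correction : Location → ℝ
  correction_measurable : Measurable correction
  /-- downlink data power of a station on a PRB -/
  dlPower : Fin (n + 1) → Fin numPRB → ℝ≥0
  /-- locations of the active users when the parameter vector is `P` -/
  users : Param n → Finset Location
  /-- PRBs used in the uplink by the active user at a location -/
  alloc : Param n → Location → Finset (Fin numPRB)
  /-- spectral efficiency as a function of the signal to interference plus noise ratio -/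
  spectralEff : ℝ → ℝ
  spectralEff_measurable : Measurable spectralEff
  spectralEff_nonneg : ∀ x, 0 ≤ x → 0 ≤ spectralEff x
  spectralEff_le : ∀ x, 0 ≤ x → spectralEff x ≤ Real.logb 2 (1 + x)
  /-- probability density of the channel fading -/
  fading : ℝ → ℝ≥0
  fading_measurable : Measurable fading
  fading_integral : ∫⁻ x in Set.Ioi (0 : ℝ), (fading x : ℝ≥0∞) = 1
  /-- arrival rate of users per surface element -/
  arrivalRate : Location → ℝ≥0
  arrivalRate_measurable : Measurable arrivalRate
  /-- mean size of an uploaded file -/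
  meanUpload : ℝ≥0
  /-- pilot power plus offset of the macro cell, which is not optimized -/
  macroPilot : ℝ
  /-- a user whose downlink ratio is below this value is in outage -/
  sinrThreshold : ℝ
  /-- the outage level tolerated by the operator -/
  outageThreshold : ℝ

namespace HetNet

variable {n : ℕ} (net : HetNet n)

/-- Pilot power plus offset of every station. -/
def pilot (P : Param n) : Fin (n + 1) → ℝ :=
  Fin.cons net.macroPilot (fun s => P s)

/-- Coverage area of station `s`: the locations for which `s` is a best server. -/
def coverage (P : Param n) (s : Fin (n + 1)) : Set Location :=
  {r ∈ net.area | ∀ s', net.dlGain s' r * net.pilot P s' ≤ net.dlGain s r * net.pilot P s}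

open Classical in
/-- The active users in the coverage area of station `s`. -/
def cellUsers (P : Param n) (s : Fin (n + 1)) : Finset Location :=
  (net.users P).filter (fun r => r ∈ net.coverage P s)

/-- Total uplink power of a user at `r` served by `s` with `M` resource blocks (fractional power
control in dB, converted to linear scale; `-10 log₁₀` of the downlink gain is the pathloss). -/
def txPower (s : Fin (n + 1)) (r : Location) (M : ℕ) : ℝ :=
  (10 : ℝ) ^ ((min net.maxTxPower
    (net.basePower s r + 10 * Real.logb 10 M
      + net.compensation s * (-10 * Real.logb 10 (net.dlGain s r)) + net.correction r)) / 10)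

/-- Uplink power on block `k` of a user at `r` served by `s` to whom the blocks in `K` are
allocated: the total power is split equally over `K`. -/
def txPowerOn (s : Fin (n + 1)) (r : Location) (K : Finset (Fin net.numPRB))
    (k : Fin net.numPRB) : ℝ :=
  if k ∈ K then net.txPower s r K.card / K.card else 0

/-- Uplink signal to interference plus noise ratio on block `k` of a user at `r` who is served by
`s` on all the blocks; the active users of the other cells interfere. -/
def ulSINR (P : Param n) (s : Fin (n + 1)) (r : Location) (k : Fin net.numPRB) : ℝ :=
  net.txPowerOn s r Finset.univ k * net.ulGain s r /
    (net.prbBandwidth * net.noise +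
      ∑ s' ∈ Finset.univ.erase s, ∑ r' ∈ net.cellUsers P s',
        net.txPowerOn s' r' (net.alloc P r') k * net.ulGain s r')

/-- Uplink peak rate at `r` in cell `s`, averaged over the fading. -/
def ulRate (P : Param n) (s : Fin (n + 1)) (r : Location) : ℝ≥0∞ :=
  ∑ k : Fin net.numPRB, ENNReal.ofReal net.prbBandwidth *
    ∫⁻ x in Set.Ioi (0 : ℝ),
      ENNReal.ofReal (net.spectralEff (net.ulSINR P s r k * x)) * (net.fading x : ℝ≥0∞)

/-- Uplink load of cell `s`. It is infinite where a positive demand meets a zero rate. -/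
def ulLoad (P : Param n) (s : Fin (n + 1)) : ℝ≥0∞ :=
  ∫⁻ r in net.coverage P s, (net.arrivalRate r * net.meanUpload : ℝ≥0∞) / net.ulRate P s r

/-- Downlink signal to interference plus noise ratio on block `k` at `r` in cell `s`. -/
def dlSINR (s : Fin (n + 1)) (r : Location) (k : Fin net.numPRB) : ℝ :=
  net.dlPower s k * net.dlGain s r /
    (net.prbBandwidth * net.noise +
      ∑ s' ∈ Finset.univ.erase s, (net.dlPower s' k : ℝ) * net.dlGain s' r)

open Classical in
/-- Downlink outage of cell `s`: the proportion of the active users of the cell (averaged over the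
resource blocks) whose downlink ratio is below the threshold; `0` in a cell without users. -/
def outage (P : Param n) (s : Fin (n + 1)) : ℝ :=
  (((net.cellUsers P s ×ˢ (Finset.univ : Finset (Fin net.numPRB))).filter
    (fun q => net.dlSINR s q.1 q.2 < net.sinrThreshold)).card : ℝ) /
      ((net.cellUsers P s).card * net.numPRB)

/-- The update direction `h(P)` of the load-balancing algorithm: balance the uplink loads of the
macro cell and the small cell while the outage is low, otherwise reduce the outage. -/
def drift (P : Param n) : Param n :=
  WithLp.toLp 2 fun s =>
    if net.outage P s.succ < net.outageThreshold then
      (net.ulLoad P 0).toReal - (net.ulLoad P s.succ).toReal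
    else net.outageThreshold - net.outage P s.succ

end HetNet

/-! ### Recursions and differential inclusions -/

section Dynamics

variable {E : Type*} [NormedAddCommGroup E] [NormedSpace ℝ E]

/-- The set-valued regularization
`g(p) = ⋂_{γ > 0} closed convex hull of {h(p') : ‖p' - p‖ < γ}`. -/
def regularization (h : E → E) (p : E) : Set E :=
  ⋂ (γ : ℝ) (_ : 0 < γ), closedConvexHull ℝ (h '' Metric.ball p γ)

/-- `P(t+1) = P(t) + ε h(P(t))`. -/
def IsIteration (h : E → E) (ε : ℝ) (P : ℕ → E) : Prop :=
  ∀ t, P (t + 1) = P t + ε • h (P t)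

/-- `P(t+1) = P(t) + ε y(t)` with `y(t) ∈ g(P(t))`. -/
def IsRecursiveInclusion (g : E → Set E) (ε : ℝ) (P : ℕ → E) : Prop :=
  ∃ y : ℕ → E, ∀ t, y t ∈ g (P t) ∧ P (t + 1) = P t + ε • y t

/-- The continuous piecewise affine path on `[0, ∞)` with value `P(t)` at time `ε t`. -/
def interpolate (ε : ℝ) (P : ℕ → E) (τ : ℝ) : E :=
  P ⌊τ / ε⌋₊ + (τ / ε - ⌊τ / ε⌋₊) • (P (⌊τ / ε⌋₊ + 1) - P ⌊τ / ε⌋₊)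

/-- `x` solves `dx/dτ ∈ g(x)` on `[0, ∞)`: it is absolutely continuous on compact intervals and
satisfies the inclusion at almost every time. -/
def IsDifferentialInclusionSolution (g : E → Set E) (x : ℝ → E) : Prop :=
  (∀ T : ℝ, 0 < T → AbsolutelyContinuousOnInterval x 0 T) ∧
    ∀ᵐ τ ∂(volume.restrict (Set.Ici (0 : ℝ))), ∃ v ∈ g (x τ), HasDerivAt x v τ

/-- Uniform convergence of paths on the compact subsets of `[0, ∞)`. -/
def PathTendsto (X : ℕ → ℝ → E) (x : ℝ → E) : Prop :=
  ∀ T : ℝ, 0 < T → TendstoUniformlyOn X x atTop (Set.Icc 0 T)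

/-- The differential inclusion `dx/dτ ∈ f(x)` is the limit of the recursive inclusion of `g` as the
step tends to `0`: along steps `ε k → 0`, every limit of interpolated trajectories solves the
differential inclusion, and interpolated trajectories with bounded initial values have a convergent
subsequence. -/
def IsLimitingDifferentialInclusion (g f : E → Set E) : Prop :=
  ∀ (ε : ℕ → ℝ) (P : ℕ → ℕ → E), (∀ k, 0 < ε k) → Tendsto ε atTop (𝓝 0) →
    (∀ k, IsRecursiveInclusion g (ε k) (P k)) →
    (∀ x : ℝ → E, PathTendsto (fun k => interpolate (ε k) (P k)) x →
      IsDifferentialInclusionSolution f x) ∧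
    (Bornology.IsBounded (Set.range fun k => P k 0) →
      ∃ (φ : ℕ → ℕ) (x : ℝ → E), StrictMono φ ∧
        PathTendsto (fun k => interpolate (ε (φ k)) (P (φ k))) x)

end Dynamics

end

/-!
As loads and outages are at most `1`, `h` is bounded. On a cell `[ε t, ε (t + 1)]` the slope of an
interpolated trajectory is the velocity `y(t)`, so the slope over any interval is a convex
combination of velocities and stays in every convex set that contains them. With a ball as the
convex set, the interpolated trajectories share a Lipschitz constant, which gives the convergent
subsequence by the Arzelà–Ascoli theorem. With the closed convex hull of the values of `h` near
`x(τ)` as the convex set, the slopes of a limit path `x` over short intervals `[τ, τ + δ]` lie in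
that hull, hence so does `ẋ(τ)`, which exists for almost every `τ` because `x` is Lipschitz.
-/

section Regularization

variable {E : Type*} [NormedAddCommGroup E] [NormedSpace ℝ E] {h : E → E} {p : E}

theorem self_mem_regularization (h : E → E) (p : E) : h p ∈ regularization h p :=
  Set.mem_iInter₂.2 fun _ hγ =>
    subset_closedConvexHull (Set.mem_image_of_mem h (Metric.mem_ball_self hγ))

theorem regularization_subset_closedConvexHull_image {s : Set E} (hs : s ∈ 𝓝 p) :
    regularization h p ⊆ closedConvexHull ℝ (h '' s) := by
  obtain ⟨γ, hγ, hball⟩ := Metric.mem_nhds_iff.1 hs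
  exact (Set.iInter₂_subset γ hγ).trans ((closedConvexHull ℝ).monotone (Set.image_mono hball))

theorem regularization_subset_closedBall {C : ℝ} (hC : ∀ q, ‖h q‖ ≤ C) :
    regularization h p ⊆ Metric.closedBall 0 C := by
  refine (regularization_subset_closedConvexHull_image univ_mem).trans
    (closedConvexHull_min ?_ (convex_closedBall 0 C) Metric.isClosed_closedBall)
  rintro _ ⟨q, -, rfl⟩
  exact mem_closedBall_zero_iff.2 (hC q)

theorem IsIteration.isRecursiveInclusion {g : E → Set E} {ε : ℝ} {P : ℕ → E}
    (hP : IsIteration h ε P) (hg : ∀ q, h q ∈ g q) : IsRecursiveInclusion g ε P :=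
  ⟨fun t => h (P t), fun t => ⟨hg (P t), hP t⟩⟩

end Regularization

theorem slope_mem_of_slope_mem_of_slope_mem {𝕜 F : Type*} [Field 𝕜] [LinearOrder 𝕜]
    [IsStrictOrderedRing 𝕜] [AddCommGroup F] [Module 𝕜 F] {f : 𝕜 → F} {K : Set F}
    (hK : Convex 𝕜 K) {a b c : 𝕜} (hab : a ≤ b) (hbc : b < c) (h₁ : slope f a b ∈ K)
    (h₂ : slope f b c ∈ K) : slope f a c ∈ K := by
  have hac : a < c := hab.trans_lt hbc
  rw [← lineMap_slope_slope_sub_div_sub f a b c hac.ne]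
  refine hK.lineMap_mem h₁ h₂ ⟨div_nonneg (sub_pos.2 hbc).le (sub_pos.2 hac).le, ?_⟩
  exact div_le_one_of_le₀ (sub_le_sub_left hab c) (sub_pos.2 hac).le

theorem lipschitzOnWith_of_norm_slope_le {F : Type*} [NormedAddCommGroup F] [NormedSpace ℝ F]
    {f : ℝ → F} {C : ℝ≥0} {s : Set ℝ}
    (hf : ∀ a ∈ s, ∀ b ∈ s, a < b → ‖slope f a b‖ ≤ C) : LipschitzOnWith C f s := by
  refine LipschitzOnWith.of_dist_le_mul fun a ha b hb => ?_
  wlog hab : a < b generalizing a b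
  · rcases (not_lt.1 hab).eq_or_lt with rfl | hba
    · simp
    · simpa only [dist_comm] using this b hb a ha hba
  calc dist (f a) (f b) = dist a b * ‖slope f a b‖ := by
        rw [dist_comm, dist_comm a, dist_eq_norm, dist_eq_norm, ← norm_smul, sub_smul_slope,
          vsub_eq_sub]
    _ ≤ C * dist a b := by
        rw [mul_comm]
        gcongr
        exact hf a ha b hb hab

section Interpolation

variable {E : Type*} [NormedAddCommGroup E] [NormedSpace ℝ E] {P : ℕ → E} {ε : ℝ}

theorem interpolate_zero (ε : ℝ) (P : ℕ → E) : interpolate ε P 0 = P 0 := by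
  simp [interpolate]

theorem interpolate_mul_natCast (hε : ε ≠ 0) (t : ℕ) : interpolate ε P (ε * t) = P t := by
  simp [interpolate, mul_div_cancel_left₀ _ hε]

theorem interpolate_eq_of_mem_Icc (hε : 0 < ε) {t : ℕ} {τ : ℝ}
    (hτ : τ ∈ Set.Icc (ε * t) (ε * (t + 1))) :
    interpolate ε P τ = P t + (τ / ε - t) • (P (t + 1) - P t) := by
  rcases hτ.2.eq_or_lt with rfl | hlt
  · have hnode := interpolate_mul_natCast (P := P) hε.ne' (t + 1)
    push_cast at hnode
    rw [hnode, mul_div_cancel_left₀ _ hε.ne']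
    module
  · have hfloor : ⌊τ / ε⌋₊ = t := by
      have ht : (t : ℝ) ≤ τ / ε := (le_div_iff₀' hε).2 hτ.1
      exact (Nat.floor_eq_iff (t.cast_nonneg.trans ht)).2 ⟨ht, (div_lt_iff₀' hε).2 hlt⟩
    rw [interpolate, hfloor]

theorem slope_interpolate_of_mem_Icc (hε : 0 < ε) {t : ℕ} {a b : ℝ}
    (ha : a ∈ Set.Icc (ε * t) (ε * (t + 1))) (hb : b ∈ Set.Icc (ε * t) (ε * (t + 1)))
    (hab : a ≠ b) : slope (interpolate ε P) a b = ε⁻¹ • (P (t + 1) - P t) := by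
  have hba : b - a ≠ 0 := sub_ne_zero.2 hab.symm
  have hε' := hε.ne'
  rw [slope_def_module, interpolate_eq_of_mem_Icc hε ha, interpolate_eq_of_mem_Icc hε hb,
    add_sub_add_left_eq_sub, ← sub_smul, smul_smul]
  congr 1
  field_simp
  ring

theorem slope_interpolate_mem_of_inv_smul_sub_mem (hε : 0 < ε) {K : Set E} (hK : Convex ℝ K)
    {a b : ℝ} (ha : 0 ≤ a) (hab : a < b)
    (hP : ∀ t : ℕ, a < ε * (t + 1) → ε * t < b → ε⁻¹ • (P (t + 1) - P t) ∈ K) :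
    slope (interpolate ε P) a b ∈ K := by
  suffices hnodes : ∀ (t : ℕ) (c : ℝ), a < c → c ≤ b → c ≤ ε * t →
      slope (interpolate ε P) a c ∈ K from
    hnodes ⌈b / ε⌉₊ b hab le_rfl ((div_le_iff₀' hε).1 (Nat.le_ceil _))
  intro t
  induction t with
  | zero => intro c hac _ hc; simp only [Nat.cast_zero, mul_zero] at hc; linarith
  | succ t ih =>
    intro c hac hcb hc
    push_cast at hc
    rcases le_or_gt c (ε * t) with hct | htc
    · exact ih c hac hcb hct
    have hcell : ∀ u, u < c → ε * t ≤ u → slope (interpolate ε P) u c ∈ K := by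
      intro u huc htu
      rw [slope_interpolate_of_mem_Icc hε ⟨htu, huc.le.trans hc⟩ ⟨htc.le, hc⟩ huc.ne]
      exact hP t (hac.trans_le hc) (htc.trans_le hcb)
    rcases le_or_gt (ε * t) a with hta | hat
    · exact hcell a hac hta
    · exact slope_mem_of_slope_mem_of_slope_mem hK hat.le htc
        (ih _ hat (htc.le.trans hcb) le_rfl) (hcell _ htc le_rfl)

namespace IsRecursiveInclusion

variable {g : E → Set E}

theorem inv_smul_sub_mem (hP : IsRecursiveInclusion g ε P) (hε : ε ≠ 0) (t : ℕ) :
    ε⁻¹ • (P (t + 1) - P t) ∈ g (P t) := by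
  obtain ⟨y, hy⟩ := hP
  rw [(hy t).2, add_sub_cancel_left, inv_smul_smul₀ hε]
  exact (hy t).1

theorem slope_interpolate_mem (hP : IsRecursiveInclusion g ε P) (hε : 0 < ε) {K : Set E}
    (hK : Convex ℝ K) {a b : ℝ} (ha : 0 ≤ a) (hab : a < b)
    (hg : ∀ s, 0 ≤ s → a - ε < s → s < b → g (interpolate ε P s) ⊆ K) :
    slope (interpolate ε P) a b ∈ K := by
  refine slope_interpolate_mem_of_inv_smul_sub_mem hε hK ha hab fun t hat htb => ?_
  have hsub := hg (ε * t) (by positivity) (by linarith) htb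
  rw [interpolate_mul_natCast hε.ne'] at hsub
  exact hsub (hP.inv_smul_sub_mem hε.ne' t)

theorem lipschitzOnWith_interpolate (hP : IsRecursiveInclusion g ε P) (hε : 0 < ε) {C : ℝ≥0}
    (hg : ∀ p, g p ⊆ Metric.closedBall 0 C) :
    LipschitzOnWith C (interpolate ε P) (Set.Ici 0) :=
  lipschitzOnWith_of_norm_slope_le fun _ ha _ _ hab => mem_closedBall_zero_iff.1 <|
    hP.slope_interpolate_mem hε (convex_closedBall 0 _) ha hab fun _ _ _ _ => hg _

end IsRecursiveInclusion

end Interpolation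

section Limit

theorem lipschitzOnWith_of_tendsto {α β ι : Type*} [PseudoMetricSpace α] [PseudoMetricSpace β]
    {l : Filter ι} [l.NeBot] {X : ι → α → β} {x : α → β} {C : ℝ≥0} {s : Set α}
    (hX : ∀ i, LipschitzOnWith C (X i) s)
    (hx : ∀ a ∈ s, Tendsto (fun i => X i a) l (𝓝 (x a))) : LipschitzOnWith C x s :=
  LipschitzOnWith.of_dist_le_mul fun a ha b hb =>
    le_of_tendsto ((hx a ha).dist (hx b hb)) (.of_forall fun i => (hX i).dist_le_mul a ha b hb)

theorem PathTendsto.tendsto {F : Type*} [NormedAddCommGroup F] {X : ℕ → ℝ → F} {x : ℝ → F}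
    (hX : PathTendsto X x) {s : ℝ} (hs : 0 ≤ s) : Tendsto (fun k => X k s) atTop (𝓝 (x s)) :=
  (hX (s + 1) (by positivity)).tendsto_at ⟨hs, by linarith⟩

variable {E : Type*} [NormedAddCommGroup E] [NormedSpace ℝ E] {h : E → E} {C : ℝ≥0}
  {ε : ℕ → ℝ} {P : ℕ → ℕ → E} {x : ℝ → E}

theorem slope_mem_closedConvexHull_of_tendsto_interpolate (hC : ∀ p, ‖h p‖ ≤ C)
    (hε : ∀ k, 0 < ε k) (hε0 : Tendsto ε atTop (𝓝 0))
    (hP : ∀ k, IsRecursiveInclusion (regularization h) (ε k) (P k))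
    (hx : ∀ s ∈ Set.Ici 0, Tendsto (fun k => interpolate (ε k) (P k) s) atTop (𝓝 (x s)))
    {a b γ : ℝ} (ha : 0 ≤ a) (hab : a < b) (hγ : C * (b - a) < γ) :
    slope x a b ∈ closedConvexHull ℝ (h '' Metric.ball (x a) γ) := by
  set X := fun k => interpolate (ε k) (P k)
  have hslope : Tendsto (fun k => slope (X k) a b) atTop (𝓝 (slope x a b)) :=
    ((hx b (ha.trans hab.le)).sub (hx a ha)).const_smul _
  have hradius : Tendsto (fun k => C * (b - a + ε k) + dist (X k a) (x a)) atTop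
      (𝓝 (C * (b - a))) := by
    simpa using ((hε0.const_add (b - a)).const_mul (C : ℝ)).add
      (tendsto_iff_dist_tendsto_zero.1 (hx a ha))
  refine isClosed_closedConvexHull.mem_of_tendsto hslope ?_
  filter_upwards [hradius.eventually_lt_const hγ] with k hk
  refine (hP k).slope_interpolate_mem (hε k) convex_closedConvexHull ha hab fun s hs has hsb =>
    regularization_subset_closedConvexHull_image (Metric.isOpen_ball.mem_nhds ?_)
  have hlip : LipschitzOnWith C (X k) (Set.Ici 0) :=
    (hP k).lipschitzOnWith_interpolate (hε k) fun _ => regularization_subset_closedBall hC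
  have hdist : dist s a ≤ b - a + ε k := by
    rw [Real.dist_eq, abs_le]
    constructor <;> linarith [hε k]
  calc dist (X k s) (x a) ≤ dist (X k s) (X k a) + dist (X k a) (x a) := dist_triangle _ _ _
    _ ≤ C * (b - a + ε k) + dist (X k a) (x a) := by
        gcongr
        exact (hlip.dist_le_mul s hs a ha).trans (by gcongr)
    _ < γ := hk

theorem mem_regularization_of_hasDerivAt {τ : ℝ} {v : E}
    (hslope : ∀ b γ, τ < b → C * (b - τ) < γ →
      slope x τ b ∈ closedConvexHull ℝ (h '' Metric.ball (x τ) γ))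
    (hv : HasDerivAt x v τ) : v ∈ regularization h (x τ) := by
  refine Set.mem_iInter₂.2 fun γ hγ => ?_
  refine isClosed_closedConvexHull.mem_of_tendsto
    (hasDerivAt_iff_tendsto_slope_left_right.1 hv).2 ?_
  have hshort : ∀ᶠ b in 𝓝[>] τ, C * (b - τ) < γ := by
    refine nhdsWithin_le_nhds (ContinuousAt.eventually_lt (by fun_prop) continuousAt_const ?_)
    simpa using hγ
  filter_upwards [hshort, self_mem_nhdsWithin] with b hb hτb
  exact hslope b γ hτb hb

theorem isDifferentialInclusionSolution_of_tendsto_interpolate [FiniteDimensional ℝ E]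
    (hC : ∀ p, ‖h p‖ ≤ C) (hε : ∀ k, 0 < ε k) (hε0 : Tendsto ε atTop (𝓝 0))
    (hP : ∀ k, IsRecursiveInclusion (regularization h) (ε k) (P k))
    (hx : ∀ s ∈ Set.Ici 0, Tendsto (fun k => interpolate (ε k) (P k) s) atTop (𝓝 (x s))) :
    IsDifferentialInclusionSolution (regularization h) x := by
  have hlip : LipschitzOnWith C x (Set.Ici 0) :=
    lipschitzOnWith_of_tendsto (fun k => (hP k).lipschitzOnWith_interpolate (hε k)
      fun _ => regularization_subset_closedBall hC) hx
  refine ⟨fun T hT => (hlip.mono ?_).absolutelyContinuousOnInterval, ?_⟩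
  · rw [Set.uIcc_of_le hT.le]
    exact Set.Icc_subset_Ici_self
  · rw [← restrict_Ioi_eq_restrict_Ici, ae_restrict_iff' measurableSet_Ioi]
    filter_upwards [hlip.ae_differentiableWithinAt_of_mem_real] with τ hdiff hτ
    have hderiv : HasDerivAt x (deriv x τ) τ :=
      ((hdiff (Set.Ioi_subset_Ici_self hτ)).differentiableAt (Ici_mem_nhds hτ)).hasDerivAt
    have hmem : deriv x τ ∈ regularization h (x τ) :=
      mem_regularization_of_hasDerivAt (fun b γ =>
        slope_mem_closedConvexHull_of_tendsto_interpolate hC hε hε0 hP hx (le_of_lt hτ)) hderiv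
    exact ⟨_, hmem, hderiv⟩

end Limit

theorem isCompact_setOf_lipschitzWith_mem_closedBall {α β : Type*} [PseudoMetricSpace α]
    [MetricSpace β] [ProperSpace β] (C : ℝ≥0) (a : α) (b : β) (R : ℝ) :
    IsCompact {f : C(α, β) | LipschitzWith C f ∧ f a ∈ Metric.closedBall b R} := by
  refine ArzelaAscoli.isCompact_of_equicontinuous _ ?_
    (LipschitzWith.uniformEquicontinuous _ C fun f => f.2.1).equicontinuous
  have himage : ContinuousMap.toFun ''
      {f : C(α, β) | LipschitzWith C f ∧ f a ∈ Metric.closedBall b R} =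
      {f | LipschitzWith C f} ∩ {f | f a ∈ Metric.closedBall b R} := by
    ext f
    refine ⟨?_, fun hf => ⟨⟨f, hf.1.continuous⟩, hf, rfl⟩⟩
    rintro ⟨f, hf, rfl⟩
    exact hf
  rw [himage]
  refine (isCompact_univ_pi fun c => isCompact_closedBall b (C * dist c a + R)).of_isClosed_subset
    ((isClosed_setOfPred_lipschitzWith C).inter
      (Metric.isClosed_closedBall.preimage (continuous_apply a))) ?_
  rintro f ⟨hf, hfa⟩ c -
  exact (dist_triangle _ (f a) _).trans (add_le_add (hf.dist_le_mul c a) hfa)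

theorem exists_pathTendsto_subseq_of_lipschitzOnWith {F : Type*} [NormedAddCommGroup F]
    [ProperSpace F] {X : ℕ → ℝ → F} {C : ℝ≥0} (hX : ∀ k, LipschitzOnWith C (X k) (Set.Ici 0))
    (hbd : Bornology.IsBounded (Set.range fun k => X k 0)) :
    ∃ (φ : ℕ → ℕ) (x : ℝ → F), StrictMono φ ∧ PathTendsto (fun k => X (φ k)) x := by
  obtain ⟨R, hR⟩ := hbd.subset_closedBall 0
  have hlip (k : ℕ) : LipschitzWith C fun τ => X k (max τ 0) := by
    rw [← lipschitzOnWith_univ, ← mul_one C]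
    exact (hX k).comp (LipschitzWith.id.max_const 0).lipschitzOnWith fun τ _ => le_max_right τ 0
  let f (k : ℕ) : C(ℝ, F) := ⟨fun τ => X k (max τ 0), (hlip k).continuous⟩
  have hf (k : ℕ) : LipschitzWith C (f k) ∧ f k 0 ∈ Metric.closedBall 0 R :=
    ⟨hlip k, by simpa [f] using hR (Set.mem_range_self k)⟩
  obtain ⟨x, -, φ, hφ, hlim⟩ :=
    (isCompact_setOf_lipschitzWith_mem_closedBall C 0 0 R).tendsto_subseq hf
  refine ⟨φ, x, hφ, fun T _ => ?_⟩
  refine (ContinuousMap.tendsto_iff_forall_isCompact_tendstoUniformlyOn.1 hlim _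
    isCompact_Icc).congr (.of_forall fun k τ hτ => ?_)
  simp [f, max_eq_left hτ.1]

theorem isLimitingDifferentialInclusion_regularization {E : Type*} [NormedAddCommGroup E]
    [NormedSpace ℝ E] [FiniteDimensional ℝ E] {h : E → E} {C : ℝ} (hC : ∀ p, ‖h p‖ ≤ C) :
    IsLimitingDifferentialInclusion (regularization h) (regularization h) := by
  intro ε P hε hε0 hP
  lift C to ℝ≥0 using (norm_nonneg _).trans (hC 0)
  refine ⟨fun x hx => ?_, fun hbd => ?_⟩
  · exact isDifferentialInclusionSolution_of_tendsto_interpolate hC hε hε0 hP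
      fun s hs => hx.tendsto hs
  · have : ProperSpace E := FiniteDimensional.proper ℝ E
    refine exists_pathTendsto_subseq_of_lipschitzOnWith
      (X := fun k => interpolate (ε k) (P k)) (C := C) (fun k => ?_) ?_
    · exact (hP k).lipschitzOnWith_interpolate (hε k) fun _ => regularization_subset_closedBall hC
    · simpa only [interpolate_zero] using hbd

namespace HetNet

variable {n : ℕ} (net : HetNet n)

theorem outage_nonneg (P : Param n) (s : Fin (n + 1)) : 0 ≤ net.outage P s := by
  unfold outage
  positivity

theorem outage_le_one (P : Param n) (s : Fin (n + 1)) : net.outage P s ≤ 1 := by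
  refine div_le_one_of_le₀ ?_ (by positivity)
  exact_mod_cast (Finset.card_filter_le _ _).trans (by simp [Finset.card_product])

variable {net} {M : ℝ≥0} {P : Param n}

theorem abs_drift_apply_le (hload : ∀ s, net.ulLoad P s ≤ M) (s : Fin n) :
    |net.drift P s| ≤ max (M : ℝ) (|net.outageThreshold| + 1) := by
  have htoReal (s : Fin (n + 1)) : (net.ulLoad P s).toReal ≤ M :=
    ENNReal.toReal_le_coe_of_le_coe (hload s)
  simp only [drift]
  split_ifs
  · exact le_max_of_le_left <| abs_sub_le_of_nonneg_of_le ENNReal.toReal_nonneg (htoReal 0)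
      ENNReal.toReal_nonneg (htoReal s.succ)
  · refine le_max_of_le_right ((abs_sub _ _).trans ?_)
    rw [abs_of_nonneg (net.outage_nonneg P s.succ)]
    gcongr
    exact net.outage_le_one P s.succ

theorem norm_drift_le (hload : ∀ s, net.ulLoad P s ≤ M) :
    ‖net.drift P‖ ≤ √n * max (M : ℝ) (|net.outageThreshold| + 1) := by
  set B := max (M : ℝ) (|net.outageThreshold| + 1)
  have hB : 0 ≤ B := le_max_of_le_left M.2
  calc ‖net.drift P‖ = √(∑ s, ‖net.drift P s‖ ^ 2) := EuclideanSpace.norm_eq _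
    _ ≤ √(∑ _s : Fin n, B ^ 2) := by
        gcongr with s
        exact abs_drift_apply_le hload s
    _ = √n * B := by simp [Real.sqrt_mul, Real.sqrt_sq hB]

end HetNet

theorem proposition1_general {E : Type*} [NormedAddCommGroup E] [NormedSpace ℝ E]
    [FiniteDimensional ℝ E] {h : E → E} {C : ℝ} (hC : ∀ p, ‖h p‖ ≤ C) :
    (∀ p, h p ∈ regularization h p) ∧
    (∀ (ε : ℝ) (P : ℕ → E), IsIteration h ε P → IsRecursiveInclusion (regularization h) ε P) ∧
    IsLimitingDifferentialInclusion (regularization h) (regularization h) :=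
  ⟨self_mem_regularization h,
    fun _ _ hP => hP.isRecursiveInclusion (self_mem_regularization h),
    isLimitingDifferentialInclusion_regularization hC⟩

theorem proposition1 {n : ℕ} (net : HetNet n)
    (hload : ∀ (P : Param n) (s : Fin (n + 1)), net.ulLoad P s ≤ 1) :
    (∀ P : Param n, net.drift P ∈ regularization net.drift P) ∧
    (∀ (ε : ℝ) (P : ℕ → Param n), IsIteration net.drift ε P →
      IsRecursiveInclusion (regularization net.drift) ε P) ∧
    IsLimitingDifferentialInclusion (regularization net.drift) (regularization net.drift) :=
  proposition1_general fun P => HetNet.norm_drift_le (M := 1) (hload P)
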